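/- **Notation.** Let $D^4$ be the free modular lattice with unity $I$ on four generators $e_1,e_2,e_3,e_4$ (join $a+b$, meet $ab$). A representation $\rho$ of $D^4$ in a finite-dimensional vector space $X$ over a field $K$ is a morphism of lattices with unity from $D^4$ to the lattice of subspaces of $X$ (so $\rho(I)=X$). The representation $\Phi^+\rho$ lives in the space $$X_0^1=\Big\{(\xi_1,\xi_2,\xi_3,\xi_4)\ \Big|\ \xi_i\in\rho(e_i),\ \sum_i\xi_i=0\Big\},\qquad \Phi^+\rho(e_i)=\{\xi\in X_0^1\mid \xi_i=0\},$$ and the elementary map $\varphi_i:X_0^1\to X$ is $(\xi_1,\xi_2,\xi_3,\xi_4)\mapsto\xi_i$. **Admissible sequences.** A non-empty sequence $i_n\dots i_1$ of indices in $\{1,2,3,4\}$ is *admissible* if adjacent indices are distinct. Two sequences are considered equal if one is obtained from the other by finitely many replacements $\dots ijl\dots=\dots ikl\dots$ with $\{i,j,k,l\}=\{1,2,3,4\}$. **Atomic elements.** $a_0^{ij}=I$ and $a_n^{ij}=e_i+e_j\,a_{n-1}^{kl}$ for $n\ge 1$, where $\{i,j,k,l\}=\{1,2,3,4\}$. To fix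 the order of $k,l$: for the upper indices $ij$ in the table below take $k<l$, and unfold the recursion with $ij$ and $kl$ alternating. **Table** (sequences with $i_1=1$; parameters $t,r,s\ge 0$). | type | $\alpha$ | $e_\alpha$ | range | |---|---|---|---| | $F21$ | $(21)^t(41)^r(31)^s$ | $e_2a^{34}_{2t-1}a^{41}_{2r}a^{31}_{2s}$ | $t\ge1$ | | $F31$ | $(31)^t(41)^r(21)^s$ | $e_3a^{24}_{2t-1}a^{41}_{2r}a^{21}_{2s}$ | $t\ge1$ | | $F41$ | $(41)^t(31)^r(21)^s$ | $e_4a^{32}_{2t-1}a^{31}_{2r}a^{21}_{2s}$ | $t\ge1$ | | $G11$ | $1(21)^t(31)^s(41)^r$ | $e_1a^{34}_{2t}a^{32}_{2r}a^{24}_{2s}$ | | | $G21$ | $2(41)^r(31)^s(21)^t$ | $e_2a^{34}_{2t}a^{14}_{2r-1}a^{31}_{2s+1}$ | $r\ge1$ | | $G31$ | $3(41)^r(21)^s(31)^t$ | $e_3a^{24}_{2t}a^{14}_{2r-1}a^{21}_{2s+1}$ | $r\ge1$ | | $G41$ | $4(21)^r(31)^s(41)^t$ | $e_4a^{32}_{2t}a^{21}_{2r-1}a^{31}_{2s+1}$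 | $r\ge1$ | | $H11$ | $(14)^r(31)^s(21)^t$ | $e_1a^{34}_{2t+1}a^{32}_{2r-1}a^{24}_{2s-1}$ | $r,s\ge1$ | | $H21$ | $2(14)^r(31)^s(21)^t$ | $e_2a^{34}_{2t+2}a^{14}_{2r-1}a^{31}_{2s-1}$ | $r,s\ge1$ | | $H31$ | $3(14)^r(31)^s(21)^t$ | $e_3a^{21}_{2t+1}a^{14}_{2r-1}a^{24}_{2s}$ | $r,s\ge1$ | | $H41$ | $4(14)^r(31)^s(21)^t$ | $e_4a^{21}_{2t+1}a^{32}_{2r}a^{31}_{2s-1}$ | $r,s\ge1$ | Further, $f_{10}=e_1(e_2+e_3+e_4)$, and for every other $\alpha=i_n\dots i_1$ of the table, with $e_\alpha=e_{i_n}a_xb_yc_z$ where $a_x,b_y,c_z$ are the three atomic factors (with lower indices $x,y,z$) in any order for which $x\ge1$, $$f_{\alpha0}=e_\alpha\,(e_{i_n}c_{z+1}+b_{y+1}a_{x-1}).$$ For sequences with arbitrary $i_1$ the elements $e_\alpha$, $f_{\alpha0}$ are obtained from these by permuting the indices $1,2,3,4$ simultaneously in $\alpha$ and in the generators. (An admissible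 sequence may be equal to several table sequences, and $f_{\alpha 0}$ has several expressions; the theorem holds for each choice.) **Theorem.** 1. For every permutation $\sigma$ of $\{1,2,3,4\}$, every admissible sequence with $i_1=\sigma(1)$ is equal to one of the sequences of the $11$ types of the table with the indices permuted by $\sigma$. In particular, an admissible sequence with $i_1=1$ is equal to one of the table. 2. Let $\alpha=i_n\dots i_1$ be an admissible sequence and $i\ne i_n$. Then $i\alpha$ is admissible, elements $e_\alpha,f_{\alpha0},e_{i\alpha},f_{i\alpha0}$ are given by the table, and for $z_\alpha=e_\alpha$ and for $z_\alpha=f_{\alpha0}$ (with whichever expressions for $z_\alpha$ and $z_{i\alpha}$) $$\varphi_i\,\Phi^+\rho(z_\alpha)=\rho(z_{i\alpha})$$ for every representation $\rho$ of $D^4$ in a finite-dimensional vector space over any field. -/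

import Mathlib

/-! Admissible sequences and admissible elements for the free modular lattice `D⁴` with unity.

The four indices `1, 2, 3, 4` are the four elements of `Fin 4` (there `4` is another name of `0`,
so the numerals `1, 2, 3, 4` are pairwise distinct and exhaust `Fin 4`). -/

namespace D4Lattice

/-- Lattice polynomials in four generators and the unity. -/
inductive Term : Type
  | gen : Fin 4 → Term
  | unity : Term
  | sup : Term → Term → Term
  | inf : Term → Term → Term

/-- The inequalities between lattice polynomials that hold in all modular lattices with unity:
the least preorder for which `sup`, `inf`, `unity` are join, meet, greatest element and
the modular law holds. -/
inductive Term.Le : Term → Term → Prop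
  | refl (a) : Term.Le a a
  | trans {a b c} : Term.Le a b → Term.Le b c → Term.Le a c
  | le_unity (a) : Term.Le a Term.unity
  | le_sup_left (a b) : Term.Le a (Term.sup a b)
  | le_sup_right (a b) : Term.Le b (Term.sup a b)
  | sup_le {a b c} : Term.Le a c → Term.Le b c → Term.Le (Term.sup a b) c
  | inf_le_left (a b) : Term.Le (Term.inf a b) a
  | inf_le_right (a b) : Term.Le (Term.inf a b) b
  | le_inf {a b c} : Term.Le a b → Term.Le a c → Term.Le a (Term.inf b c)
  | modular {a b c} : Term.Le a c →
      Term.Le (Term.inf (Term.sup a b) c) (Term.sup a (Term.inf b c))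

instance Term.setoid : Setoid Term where
  r a b := Term.Le a b ∧ Term.Le b a
  iseqv := ⟨fun a => ⟨.refl a, .refl a⟩, fun h => ⟨h.2, h.1⟩,
    fun h h' => ⟨h.1.trans h'.1, h'.2.trans h.2⟩⟩

/-- The free modular lattice `D⁴` on four generators, with unity. -/
def D4 : Type := Quotient Term.setoid

namespace D4

/-- The generators `e₁, e₂, e₃, e₄`. -/
def e (i : Fin 4) : D4 := Quotient.mk _ (Term.gen i)

instance instLattice : Lattice D4 where
  le := Quotient.lift₂ Term.Le fun _ _ _ _ h h' => propext
    ⟨fun k => (h.2.trans k).trans h'.1, fun k => (h.1.trans k).trans h'.2⟩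
  le_refl := by rintro ⟨a⟩; exact Term.Le.refl a
  le_trans := by rintro ⟨a⟩ ⟨b⟩ ⟨c⟩ h h'; exact Term.Le.trans h h'
  le_antisymm := by rintro ⟨a⟩ ⟨b⟩ h h'; exact Quotient.sound ⟨h, h'⟩
  sup := Quotient.map₂ Term.sup fun _ _ h _ _ h' =>
    ⟨.sup_le (h.1.trans (.le_sup_left _ _)) (h'.1.trans (.le_sup_right _ _)),
     .sup_le (h.2.trans (.le_sup_left _ _)) (h'.2.trans (.le_sup_right _ _))⟩
  le_sup_left := by rintro ⟨a⟩ ⟨b⟩; exact Term.Le.le_sup_left a b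
  le_sup_right := by rintro ⟨a⟩ ⟨b⟩; exact Term.Le.le_sup_right a b
  sup_le := by rintro ⟨a⟩ ⟨b⟩ ⟨c⟩ h h'; exact Term.Le.sup_le h h'
  inf := Quotient.map₂ Term.inf fun _ _ h _ _ h' =>
    ⟨.le_inf ((Term.Le.inf_le_left _ _).trans h.1) ((Term.Le.inf_le_right _ _).trans h'.1),
     .le_inf ((Term.Le.inf_le_left _ _).trans h.2) ((Term.Le.inf_le_right _ _).trans h'.2)⟩
  inf_le_left := by rintro ⟨a⟩ ⟨b⟩; exact Term.Le.inf_le_left a b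
  inf_le_right := by rintro ⟨a⟩ ⟨b⟩; exact Term.Le.inf_le_right a b
  le_inf := by rintro ⟨a⟩ ⟨b⟩ ⟨c⟩ h h'; exact Term.Le.le_inf h h'

instance instOrderTop : OrderTop D4 where
  top := Quotient.mk _ Term.unity
  le_top := by rintro ⟨a⟩; exact Term.Le.le_unity a

instance instModular : IsModularLattice D4 where
  sup_inf_le_assoc_of_le := by
    rintro ⟨a⟩ ⟨b⟩ ⟨c⟩ h; exact Term.Le.modular h

end D4

section lift
variable {L : Type*} [Lattice L] [OrderTop L]

/-- The value of a lattice polynomial. -/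
def Term.eval (v : Fin 4 → L) : Term → L
  | .gen i => v i
  | .unity => ⊤
  | .sup a b => a.eval v ⊔ b.eval v
  | .inf a b => a.eval v ⊓ b.eval v

theorem Term.Le.eval_le [IsModularLattice L] (v : Fin 4 → L) {a b : Term} (h : Term.Le a b) :
    a.eval v ≤ b.eval v := by
  induction h with
  | refl a => exact le_rfl
  | trans _ _ h h' => exact h.trans h'
  | le_unity a => exact le_top
  | le_sup_left a b => exact _root_.le_sup_left
  | le_sup_right a b => exact _root_.le_sup_right
  | sup_le _ _ h h' => exact _root_.sup_le h h'
  | inf_le_left a b => exact _root_.inf_le_left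
  | inf_le_right a b => exact _root_.inf_le_right
  | le_inf _ _ h h' => exact _root_.le_inf h h'
  | modular _ h => exact IsModularLattice.sup_inf_le_assoc_of_le _ h

/-- The universal property: the morphism from `D⁴` with prescribed values on the generators. -/
def D4.lift [IsModularLattice L] (v : Fin 4 → L) : LatticeHom D4 L where
  toFun := Quotient.lift (Term.eval v) fun _ _ h =>
    le_antisymm (h.1.eval_le v) (h.2.eval_le v)
  map_sup' := by rintro ⟨a⟩ ⟨b⟩; rfl
  map_inf' := by rintro ⟨a⟩ ⟨b⟩; rfl

end lift

/-- A linear representation of `D⁴` in the space `X`: a morphism of lattices with unity from `D⁴`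
to the lattice of subspaces of `X`. -/
structure SubspaceRep (K X : Type*) [Field K] [AddCommGroup X] [Module K X] where
  toHom : LatticeHom D4 (Submodule K X)
  map_unity : toHom ⊤ = ⊤

section Coxeter
variable {K X : Type*} [Field K] [AddCommGroup X] [Module K X]

/-- The representation with prescribed images of the generators. -/
def SubspaceRep.ofSubspaces (V : Fin 4 → Submodule K X) : SubspaceRep K X := ⟨D4.lift V, rfl⟩

/-- The space `X₀¹ = {(ξ₁, ξ₂, ξ₃, ξ₄) | ξᵢ ∈ ρ(eᵢ), ∑ ξᵢ = 0}` of the representation `Φ⁺ρ`. -/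
def SubspaceRep.coxeterSpace (ρ : SubspaceRep K X) : Submodule K (Fin 4 → X) where
  carrier := {ξ | (∀ i, ξ i ∈ ρ.toHom (D4.e i)) ∧ ∑ i, ξ i = 0}
  add_mem' := fun {a b} ha hb => ⟨fun i => add_mem (ha.1 i) (hb.1 i), by
    simp only [Pi.add_apply, Finset.sum_add_distrib, ha.2, hb.2, add_zero]⟩
  zero_mem' := ⟨fun _ => zero_mem _, by simp⟩
  smul_mem' := fun c a ha => ⟨fun i => Submodule.smul_mem _ c (ha.1 i), by
    simp only [Pi.smul_apply, ← Finset.smul_sum, ha.2, smul_zero]⟩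

/-- The elementary map `φᵢ : X₀¹ → X`, `(ξ₁, ξ₂, ξ₃, ξ₄) ↦ ξᵢ`. -/
def SubspaceRep.phi (ρ : SubspaceRep K X) (i : Fin 4) : ρ.coxeterSpace →ₗ[K] X :=
  LinearMap.proj i ∘ₗ ρ.coxeterSpace.subtype

/-- The Coxeter functor: `Φ⁺ρ` is the representation in `X₀¹` that takes the generator `eᵢ` to
`{(ξ₁, ξ₂, ξ₃, ξ₄) ∈ X₀¹ | ξᵢ = 0}`. -/
def SubspaceRep.coxeter (ρ : SubspaceRep K X) : SubspaceRep K ρ.coxeterSpace :=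
  SubspaceRep.ofSubspaces fun i => LinearMap.ker (ρ.phi i)

end Coxeter

/-- A sequence `iₙ … i₁` is the list `[iₙ, …, i₁]`. It is admissible if it is non-empty and
adjacent indices are distinct. -/
def Admissible (α : List (Fin 4)) : Prop := α ≠ [] ∧ α.IsChain (· ≠ ·)

/-- One replacement `… i j l … = … i k l …` with `i, j, k, l` all distinct. -/
inductive Step : List (Fin 4) → List (Fin 4) → Prop
  | mk (u v : List (Fin 4)) (i j k l : Fin 4) (h : [i, j, k, l].Nodup) :
      Step (u ++ [i, j, l] ++ v) (u ++ [i, k, l] ++ v)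

/-- Equality of admissible sequences: a finite number of replacements leads from one to the
other. -/
def SameSeq : List (Fin 4) → List (Fin 4) → Prop := Relation.EqvGen Step

/-- The `11` types of admissible sequences with `i₁ = 1`. -/
inductive AdmType : Type
  | F21 | F31 | F41 | G11 | G21 | G31 | G41 | H11 | H21 | H31 | H41

/-- `pw i j n` is `(ij)ⁿ`. -/
def pw (i j : Fin 4) (n : ℕ) : List (Fin 4) := (List.replicate n [i, j]).flatten

/-- The range of the parameters `t, r, s` in each type. -/
def AdmType.Valid (t r s : ℕ) : AdmType → Prop
  | .F21 | .F31 | .F41 => 1 ≤ t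
  | .G11 => True
  | .G21 | .G31 | .G41 => 1 ≤ r
  | .H11 | .H21 | .H31 | .H41 => 1 ≤ r ∧ 1 ≤ s

/-- The sequence of each type with parameters `t, r, s`. -/
def AdmType.word (t r s : ℕ) : AdmType → List (Fin 4)
  | .F21 => pw 2 1 t ++ pw 4 1 r ++ pw 3 1 s
  | .F31 => pw 3 1 t ++ pw 4 1 r ++ pw 2 1 s
  | .F41 => pw 4 1 t ++ pw 3 1 r ++ pw 2 1 s
  | .G11 => [1] ++ pw 2 1 t ++ pw 3 1 s ++ pw 4 1 r
  | .G21 => [2] ++ pw 4 1 r ++ pw 3 1 s ++ pw 2 1 t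
  | .G31 => [3] ++ pw 4 1 r ++ pw 2 1 s ++ pw 3 1 t
  | .G41 => [4] ++ pw 2 1 r ++ pw 3 1 s ++ pw 4 1 t
  | .H11 => pw 1 4 r ++ pw 3 1 s ++ pw 2 1 t
  | .H21 => [2] ++ pw 1 4 r ++ pw 3 1 s ++ pw 2 1 t
  | .H31 => [3] ++ pw 1 4 r ++ pw 3 1 s ++ pw 2 1 t
  | .H41 => [4] ++ pw 1 4 r ++ pw 3 1 s ++ pw 2 1 t

/-- The leftmost index `iₙ` of the sequences of each type. -/
def AdmType.lead : AdmType → Fin 4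
  | .G11 | .H11 => 1
  | .F21 | .G21 | .H21 => 2
  | .F31 | .G31 | .H31 => 3
  | .F41 | .G41 | .H41 => 4

/-- For `{i, j, k, l} = {1, 2, 3, 4}`, `atom i j k l n` is the atomic element `aₙ^{ij}`:
`a₀^{ij} = I` and `aₙ^{ij} = eᵢ + eⱼ aₙ₋₁^{kl}` for `n ≥ 1`. -/
def atom (i j k l : Fin 4) : ℕ → D4
  | 0 => ⊤
  | n + 1 => D4.e i ⊔ D4.e j ⊓ atom k l i j n

/-- An atomic element, as its quadruple `(i, j, k, l)` of upper indices and its lower index. -/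
structure Factor where
  i : Fin 4
  j : Fin 4
  k : Fin 4
  l : Fin 4
  n : ℕ

/-- The three atomic factors of `e_α` for each type. -/
def AdmType.factor (t r s : ℕ) : AdmType → Fin 3 → Factor
  | .F21 => ![⟨3, 4, 1, 2, 2 * t - 1⟩, ⟨4, 1, 2, 3, 2 * r⟩, ⟨3, 1, 2, 4, 2 * s⟩]
  | .F31 => ![⟨2, 4, 1, 3, 2 * t - 1⟩, ⟨4, 1, 2, 3, 2 * r⟩, ⟨2, 1, 3, 4, 2 * s⟩]
  | .F41 => ![⟨3, 2, 1, 4, 2 * t - 1⟩, ⟨3, 1, 2, 4, 2 * r⟩, ⟨2, 1, 3, 4, 2 * s⟩]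
  | .G11 => ![⟨3, 4, 1, 2, 2 * t⟩, ⟨3, 2, 1, 4, 2 * r⟩, ⟨2, 4, 1, 3, 2 * s⟩]
  | .G21 => ![⟨3, 4, 1, 2, 2 * t⟩, ⟨1, 4, 2, 3, 2 * r - 1⟩, ⟨3, 1, 2, 4, 2 * s + 1⟩]
  | .G31 => ![⟨2, 4, 1, 3, 2 * t⟩, ⟨1, 4, 2, 3, 2 * r - 1⟩, ⟨2, 1, 3, 4, 2 * s + 1⟩]
  | .G41 => ![⟨3, 2, 1, 4, 2 * t⟩, ⟨2, 1, 3, 4, 2 * r - 1⟩, ⟨3, 1, 2, 4, 2 * s + 1⟩]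
  | .H11 => ![⟨3, 4, 1, 2, 2 * t + 1⟩, ⟨3, 2, 1, 4, 2 * r - 1⟩, ⟨2, 4, 1, 3, 2 * s - 1⟩]
  | .H21 => ![⟨3, 4, 1, 2, 2 * t + 2⟩, ⟨1, 4, 2, 3, 2 * r - 1⟩, ⟨3, 1, 2, 4, 2 * s - 1⟩]
  | .H31 => ![⟨2, 1, 3, 4, 2 * t + 1⟩, ⟨1, 4, 2, 3, 2 * r - 1⟩, ⟨2, 4, 1, 3, 2 * s⟩]
  | .H41 => ![⟨2, 1, 3, 4, 2 * t + 1⟩, ⟨3, 2, 1, 4, 2 * r⟩, ⟨3, 1, 2, 4, 2 * s - 1⟩]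

/-- The atomic element of a factor with its indices permuted by `σ` and its lower index replaced
by `n`. -/
def Factor.elem (σ : Equiv.Perm (Fin 4)) (a : Factor) (n : ℕ) : D4 :=
  atom (σ a.i) (σ a.j) (σ a.k) (σ a.l) n

/-- The table element `e_α`, with all indices permuted by `σ`:
the product of `e_{iₙ}` and the three atomic factors. -/
def tableE (σ : Equiv.Perm (Fin 4)) (T : AdmType) (t r s : ℕ) : D4 :=
  D4.e (σ T.lead) ⊓ (T.factor t r s 0).elem σ (T.factor t r s 0).n ⊓
    (T.factor t r s 1).elem σ (T.factor t r s 1).n ⊓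
    (T.factor t r s 2).elem σ (T.factor t r s 2).n

/-- `TableF σ T t r s z`: `z` is one of the expressions of the table element `f_{α0}`, with all
indices permuted by `σ`. For `α = 1` it is `e₁(e₂ + e₃ + e₄)`. Otherwise, if `a_x, b_y, c_z` are
the three atomic factors of `e_α` in any order for which `x ≥ 1`, it is
`e_α (e_{iₙ} c_{z+1} + b_{y+1} a_{x-1})`. -/
inductive TableF (σ : Equiv.Perm (Fin 4)) : AdmType → ℕ → ℕ → ℕ → D4 → Prop
  | one : TableF σ .G11 0 0 0 (D4.e (σ 1) ⊓ (D4.e (σ 2) ⊔ D4.e (σ 3) ⊔ D4.e (σ 4)))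
  | mk (T : AdmType) (t r s : ℕ) (π : Equiv.Perm (Fin 3))
      (h : 1 ≤ (T.factor t r s (π 0)).n) :
      TableF σ T t r s (tableE σ T t r s ⊓
        (D4.e (σ T.lead) ⊓ (T.factor t r s (π 2)).elem σ ((T.factor t r s (π 2)).n + 1) ⊔
          (T.factor t r s (π 1)).elem σ ((T.factor t r s (π 1)).n + 1) ⊓
          (T.factor t r s (π 0)).elem σ ((T.factor t r s (π 0)).n - 1)))

/-- `z` is an admissible element `e_α`. -/
def IsE (α : List (Fin 4)) (z : D4) : Prop :=
  ∃ (σ : Equiv.Perm (Fin 4)) (T : AdmType) (t r s : ℕ), T.Valid t r s ∧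
    SameSeq α ((T.word t r s).map σ) ∧ z = tableE σ T t r s

/-- `z` is an admissible element `f_{α0}`. -/
def IsF (α : List (Fin 4)) (z : D4) : Prop :=
  ∃ (σ : Equiv.Perm (Fin 4)) (T : AdmType) (t r s : ℕ), T.Valid t r s ∧
    SameSeq α ((T.word t r s).map σ) ∧ TableF σ T t r s z

end D4Lattice

open D4Lattice

/-! Write `α = iₙ … i₁`. Both identities come from a description of `ρ(z_α)` that makes no reference
to the table: it is the image of `((Φ⁺)ⁿ⁻¹ρ)(z_{i₁})` under the composition `φ_{iₙ} ⋯ φ_{i₂}`, which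
depends only on the class of `α` because `φᵢφⱼ = -φᵢφₖ` on `(Φ⁺)²ρ(eₗ)`.

The class of `α` is determined by `i₁` together with three numbers: for each of the three perfect
matchings of `{1, 2, 3, 4}`, how many adjacent pairs of `α` lie in it. These numbers are the lower
indices of the atomic factors of `e_α`, a single application of `φᵢ` raises one of them by one, and
the table lists the sequences by their parities. -/

universe u v

namespace D4Lattice

open D4

section Matching

/-- The perfect matching of `{1, 2, 3, 4}` that contains the pair `{i, j}` of distinct indices.
As `Fin 4` is a Klein four-group under `^^^`, two such pairs lie in the same matching exactly if
they have the same `i ^^^ j`, so the three matchings are encoded by `1, 2, 3`; `0` is the value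
at the degenerate pairs. -/
def matching (i j : Fin 4) : Fin 4 := i ^^^ j

theorem matching_comm (i j : Fin 4) : matching i j = matching j i := by
  decide +revert

theorem matching_left_inj {i j m : Fin 4} : matching i m = matching j m ↔ i = j := by
  decide +revert

theorem matching_right_inj {i j m : Fin 4} : matching m i = matching m j ↔ i = j := by
  decide +revert

theorem matching_ne_zero {i j : Fin 4} : matching i j ≠ 0 ↔ i ≠ j := by
  decide +revert

theorem matching_eq_of_nodup {i j k l : Fin 4} (h : [i, j, k, l].Nodup) :
    matching i j = matching k l := by
  decide +revert

theorem exists_matching_eq (j w : Fin 4) : ∃ m, matching j m = w := by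
  decide +revert

theorem exists_nodup {i j : Fin 4} (h : i ≠ j) : ∃ k l, [i, j, k, l].Nodup := by
  decide +revert

theorem exists_nodup_of_triple {i j k : Fin 4} (h : [i, j, k].Nodup) :
    ∃ l, [i, j, k, l].Nodup := by
  decide +revert

theorem univ_erase_eq_of_nodup {i j k l : Fin 4} (h : [i, j, k, l].Nodup) :
    Finset.univ.erase i = {j, k, l} := by
  decide +revert

theorem sum_eq_of_nodup {A : Type*} [AddCommMonoid A] {i j k l : Fin 4} (h : [i, j, k, l].Nodup)
    (f : Fin 4 → A) : ∑ m, f m = f i + f j + f k + f l := by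
  have huniv : Finset.univ = [i, j, k, l].toFinset := by decide +revert
  rw [huniv, List.sum_toFinset f h]
  simp only [List.map_cons, List.map_nil, List.sum_cons, List.sum_nil, add_zero, add_assoc]

end Matching

section ModularLattice
variable {L : Type*} [Lattice L] [IsModularLattice L]

theorem inf_inf_sup_eq_of_le {a m b c : L} (ha : a ≤ m) :
    a ⊓ (m ⊓ c ⊔ b) = a ⊓ (m ⊓ c ⊔ m ⊓ b) := by
  calc a ⊓ (m ⊓ c ⊔ b) = a ⊓ ((m ⊓ c ⊔ b) ⊓ m) := by
        rw [inf_comm _ m, ← inf_assoc, inf_eq_left.2 ha]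
    _ = a ⊓ (m ⊓ c ⊔ m ⊓ b) := by
        rw [sup_inf_assoc_of_le b inf_le_left, inf_comm b m]

theorem inf_inf_sup_inf_eq_of_le {a e m b c : L} (he : a ≤ e) (hm : a ≤ m) :
    a ⊓ (e ⊓ c ⊔ b ⊓ m) = a ⊓ (e ⊓ m ⊓ c ⊔ e ⊓ m ⊓ b) := by
  calc a ⊓ (e ⊓ c ⊔ b ⊓ m) = a ⊓ (m ⊓ (e ⊓ b) ⊔ e ⊓ c) := by
        rw [inf_inf_sup_eq_of_le he, sup_comm]; ac_rfl
    _ = a ⊓ (e ⊓ m ⊓ c ⊔ e ⊓ m ⊓ b) := by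
        rw [inf_inf_sup_eq_of_le hm, sup_comm]; ac_rfl

theorem inf_sup_sup_inf_eq (x y b : L) : x ⊓ (y ⊔ (x ⊔ y) ⊓ b) = x ⊓ (y ⊔ b) := by
  rw [inf_comm (x ⊔ y), ← sup_inf_assoc_of_le b le_sup_right, inf_comm (y ⊔ b), ← inf_assoc,
    inf_sup_self]

end ModularLattice

section Atoms

theorem e_le_atom (i j k l : Fin 4) : ∀ n, e i ≤ atom i j k l n
  | 0 => le_top
  | _ + 1 => le_sup_left

theorem atom_succ_le (i j k l : Fin 4) (n : ℕ) : atom i j k l (n + 1) ≤ atom i j k l n := by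
  induction n generalizing i j k l with
  | zero => exact le_top
  | succ n ih => exact sup_le_sup_left (inf_le_inf_left _ (ih ..)) _

mutual

theorem atom_swap_right (i j k l : Fin 4) : ∀ n, atom i j k l n = atom i j l k n
  | 0 => rfl
  | n + 1 => by
    rw [atom, atom, atom_swap_right k l i j n, e_inf_atom_swap_left k l j i n,
      atom_swap_right l k j i n]

theorem e_inf_atom_swap_left (i j k l : Fin 4) :
    ∀ n, e k ⊓ atom i j k l n = e k ⊓ atom j i k l n
  | 0 => rfl
  | n + 1 => by
    have hk : e k ≤ atom k l i j n := e_le_atom ..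
    calc e k ⊓ (e i ⊔ e j ⊓ atom k l i j n)
        = e k ⊓ (atom k l i j n ⊓ e j ⊔ atom k l i j n ⊓ e i) := by
          rw [sup_comm, inf_comm (e j), inf_inf_sup_eq_of_le hk]
      _ = e k ⊓ (e j ⊔ e i ⊓ atom k l j i n) := by
          rw [← atom_swap_right k l i j, sup_comm, ← inf_inf_sup_eq_of_le hk, sup_comm,
            inf_comm (e i)]

end

/-- The element `e_j aₙ^{kl}` with `{i, j, k, l} = {1, 2, 3, 4}`. It does not depend on the order
of `k` and `l`; the meet over both orders makes the definition free of a choice. -/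
def genAtom (j i : Fin 4) (n : ℕ) : D4 :=
  e j ⊓ (Finset.univ.filter fun p : Fin 4 × Fin 4 => [i, j, p.1, p.2].Nodup).inf
    fun p => atom p.1 p.2 i j n

theorem e_fourth_inf_atom {i j k l : Fin 4} (h : [i, j, k, l].Nodup) (n : ℕ) :
    e j ⊓ atom k l i j n = genAtom j i n := by
  have hpairs : (Finset.univ.filter fun p : Fin 4 × Fin 4 => [i, j, p.1, p.2].Nodup) =
      {(k, l), (l, k)} := by
    decide +revert
  have hswap : e j ⊓ atom l k i j n = e j ⊓ atom k l i j n := by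
    rw [atom_swap_right l k, e_inf_atom_swap_left l k j i, atom_swap_right k l]
  rw [genAtom, hpairs, Finset.inf_insert, Finset.inf_singleton, inf_inf_distrib_left, hswap,
    inf_idem]

theorem e_third_inf_atom {i j k l : Fin 4} (h : [i, j, k, l].Nodup) (n : ℕ) :
    e i ⊓ atom k l i j n = genAtom i j n := by
  rw [atom_swap_right, e_fourth_inf_atom (by grind)]

theorem genAtom_le (j i : Fin 4) (n : ℕ) : genAtom j i n ≤ e j := inf_le_left

theorem genAtom_succ_le (j i : Fin 4) (n : ℕ) : genAtom j i (n + 1) ≤ genAtom j i n :=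
  inf_le_inf_left _ (Finset.inf_mono_fun fun _ _ => atom_succ_le ..)

theorem genAtom_zero (j i : Fin 4) : genAtom j i 0 = e j := by
  simp only [genAtom, atom, Finset.inf_top, inf_top_eq]

theorem genAtom_succ {i j k l : Fin 4} (h : [i, j, k, l].Nodup) (n : ℕ) :
    genAtom j i (n + 1) = e j ⊓ (e k ⊔ genAtom l k n) := by
  rw [← e_fourth_inf_atom h, atom, e_fourth_inf_atom (show [k, l, i, j].Nodup by grind)]

theorem inf_genAtom_eq {i j k l : Fin 4} (h : [i, j, k, l].Nodup) {y : D4} (hy : y ≤ e j) (n : ℕ) :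
    y ⊓ genAtom j i n = y ⊓ atom k l i j n := by
  rw [← e_fourth_inf_atom h, ← inf_assoc, inf_eq_left.2 hy]

end Atoms

namespace SubspaceRep
variable {K : Type u} {X : Type v} [Field K] [AddCommGroup X] [Module K X] (ρ : SubspaceRep K X)

/-- The subspace `φᵢ Φ⁺ρ(z)` of the space of `ρ`. -/
def coxeterImage (i : Fin 4) (z : D4) : Submodule K X :=
  (ρ.coxeter.toHom z).map (ρ.phi i)

section CoxeterSpace

theorem toHom_mono {y z : D4} (h : y ≤ z) : ρ.toHom y ≤ ρ.toHom z :=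
  OrderHomClass.mono ρ.toHom h

theorem mem_coxeter_e {i : Fin 4} {ξ : ρ.coxeterSpace} :
    ξ ∈ ρ.coxeter.toHom (e i) ↔ ρ.phi i ξ = 0 := Iff.rfl

theorem phi_mem (i : Fin 4) (ξ : ρ.coxeterSpace) : ρ.phi i ξ ∈ ρ.toHom (e i) := ξ.2.1 i

theorem phi_eq_neg_add_neg {i j k l : Fin 4} (h : [i, j, k, l].Nodup) {ξ : ρ.coxeterSpace}
    (hj : ρ.phi j ξ = 0) : ρ.phi i ξ = -ρ.phi k ξ + -ρ.phi l ξ := by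
  have hsum : ρ.phi i ξ + ρ.phi j ξ + ρ.phi k ξ + ρ.phi l ξ = 0 :=
    (sum_eq_of_nodup h ξ.1).symm.trans ξ.2.2
  rw [hj, add_zero, add_assoc] at hsum
  rw [eq_neg_of_add_eq_zero_left hsum, neg_add]

theorem exists_phi_eq {i j k l : Fin 4} (h : [i, j, k, l].Nodup) {y z : X}
    (hy : y ∈ ρ.toHom (e k)) (hz : z ∈ ρ.toHom (e l)) (hyz : y + z ∈ ρ.toHom (e i)) :
    ∃ ξ : ρ.coxeterSpace, ρ.phi i ξ = y + z ∧ ρ.phi j ξ = 0 ∧ ρ.phi k ξ = -y := by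
  let ξ : Fin 4 → X := fun m =>
    if m = i then y + z else if m = k then -y else if m = l then -z else 0
  obtain ⟨hi, hj, hk, hl⟩ : ξ i = y + z ∧ ξ j = 0 ∧ ξ k = -y ∧ ξ l = -z := by
    grind
  refine ⟨⟨ξ, fun m => ?_, ?_⟩, hi, hj, hk⟩
  · obtain rfl | rfl | rfl | rfl : m = i ∨ m = j ∨ m = k ∨ m = l := by grind
    · rwa [hi]
    · rw [hj]; exact zero_mem _
    · rw [hk]; exact neg_mem hy
    · rw [hl]; exact neg_mem hz
  · rw [sum_eq_of_nodup h, hi, hj, hk, hl]; abel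

end CoxeterSpace

section CoxeterImage

theorem coxeterImage_mono (i : Fin 4) {y z : D4} (h : y ≤ z) :
    ρ.coxeterImage i y ≤ ρ.coxeterImage i z :=
  Submodule.map_mono (ρ.coxeter.toHom_mono h)

theorem coxeterImage_sup (i : Fin 4) (y z : D4) :
    ρ.coxeterImage i (y ⊔ z) = ρ.coxeterImage i y ⊔ ρ.coxeterImage i z := by
  simp only [coxeterImage, map_sup, Submodule.map_sup]

theorem coxeterImage_inf_of_le_left {i : Fin 4} {y : D4} (h : e i ≤ y) (z : D4) :
    ρ.coxeterImage i (y ⊓ z) = ρ.coxeterImage i y ⊓ ρ.coxeterImage i z := by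
  refine le_antisymm (le_inf (ρ.coxeterImage_mono i inf_le_left)
    (ρ.coxeterImage_mono i inf_le_right)) ?_
  rintro x ⟨⟨ξ, hξ, rfl⟩, η, hη, hηξ⟩
  have hker : η - ξ ∈ ρ.coxeter.toHom (e i) :=
    ρ.mem_coxeter_e.2 (by rw [map_sub, hηξ, sub_self])
  have hηy : η ∈ ρ.coxeter.toHom y := by
    simpa only [sub_add_cancel] using add_mem (ρ.coxeter.toHom_mono h hker) hξ
  exact ⟨η, by rw [map_inf]; exact ⟨hηy, hη⟩, hηξ⟩

theorem coxeterImage_inf_of_le_right {i : Fin 4} {z : D4} (h : e i ≤ z) (y : D4) :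
    ρ.coxeterImage i (y ⊓ z) = ρ.coxeterImage i y ⊓ ρ.coxeterImage i z := by
  rw [inf_comm, ρ.coxeterImage_inf_of_le_left h, inf_comm]

theorem coxeterImage_e_self (i : Fin 4) : ρ.coxeterImage i (e i) = ⊥ :=
  LinearMap.le_ker_iff_map.1 le_rfl

theorem coxeterImage_le (i : Fin 4) (z : D4) : ρ.coxeterImage i z ≤ ρ.toHom (e i) := by
  rintro x ⟨ξ, -, rfl⟩
  exact ρ.phi_mem i ξ

/-- The description of `X₀¹ ∩ {ξⱼ = 0}` as the triples `ξᵢ + ξₖ + ξₗ = 0`, read off at the first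
coordinate: `z` only constrains `ξₖ`, as it contains the kernel of `φₖ`. -/
theorem coxeterImage_e_inf {i j k l : Fin 4} (h : [i, j, k, l].Nodup) {z : D4} (hz : e k ≤ z) :
    ρ.coxeterImage i (e j ⊓ z) =
      ρ.toHom (e i) ⊓ (ρ.toHom (e l) ⊔ ρ.coxeterImage k (e j ⊓ z)) := by
  apply le_antisymm
  · rintro x ⟨ξ, hξ, rfl⟩
    have hj : ξ ∈ ρ.coxeter.toHom (e j) := ρ.coxeter.toHom_mono inf_le_left hξ
    refine ⟨ρ.phi_mem i ξ, ?_⟩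
    rw [ρ.phi_eq_neg_add_neg h hj, add_comm]
    exact Submodule.add_mem_sup (neg_mem (ρ.phi_mem l ξ)) (neg_mem ⟨ξ, hξ, rfl⟩)
  · rintro x ⟨hx, hx'⟩
    obtain ⟨w, hw, y, ⟨η, hη, rfl⟩, rfl⟩ := Submodule.mem_sup.1 hx'
    rw [add_comm] at hx ⊢
    obtain ⟨ξ, hi, hj, hk⟩ := ρ.exists_phi_eq h (ρ.phi_mem k η) hw hx
    have hker : ξ + η ∈ ρ.coxeter.toHom (e k) := by
      rw [mem_coxeter_e, map_add, hk, neg_add_cancel]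
    have hξ : ξ ∈ ρ.coxeter.toHom z := by
      simpa only [add_sub_cancel_right] using
        sub_mem (ρ.coxeter.toHom_mono hz hker) (ρ.coxeter.toHom_mono inf_le_right hη)
    exact ⟨ξ, by rw [map_inf]; exact ⟨hj, hξ⟩, hi⟩

theorem coxeterImage_e {i j k l : Fin 4} (h : [i, j, k, l].Nodup) :
    ρ.coxeterImage i (e j) = ρ.toHom (e i ⊓ (e k ⊔ e l)) := by
  rw [map_inf, map_sup]
  apply le_antisymm
  · rintro x ⟨ξ, hξ, rfl⟩
    refine ⟨ρ.phi_mem i ξ, ?_⟩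
    rw [ρ.phi_eq_neg_add_neg h hξ]
    exact Submodule.add_mem_sup (neg_mem (ρ.phi_mem k ξ)) (neg_mem (ρ.phi_mem l ξ))
  · rintro x ⟨hx, hx'⟩
    obtain ⟨y, hy, z, hz, rfl⟩ := Submodule.mem_sup.1 hx'
    obtain ⟨ξ, hi, hj, -⟩ := ρ.exists_phi_eq h hy hz hx
    exact ⟨ξ, hj, hi⟩

theorem coxeterImage_genAtom {i j : Fin 4} (h : i ≠ j) (n : ℕ) :
    ρ.coxeterImage i (genAtom j i n) = ρ.toHom (genAtom i j (n + 1)) := by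
  induction n generalizing i j with
  | zero =>
    obtain ⟨k, l, hijkl⟩ := exists_nodup h
    rw [genAtom_zero, ρ.coxeterImage_e hijkl, genAtom_succ (k := k) (l := l) (by grind),
      genAtom_zero]
  | succ n ih =>
    obtain ⟨k, l, hijkl⟩ := exists_nodup h
    have hk : ρ.coxeterImage k (e k ⊔ genAtom l k n) = ρ.toHom (genAtom k l (n + 1)) := by
      rw [coxeterImage_sup, coxeterImage_e_self, bot_sup_eq, ih (by grind)]
    have hkj : ρ.coxeterImage k (e j ⊓ (e k ⊔ genAtom l k n)) =
        ρ.toHom ((e i ⊔ e l) ⊓ genAtom k l (n + 1)) := by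
      rw [ρ.coxeterImage_inf_of_le_right le_sup_left, hk,
        ρ.coxeterImage_e (l := l) (k := i) (by grind), ← map_inf, inf_right_comm,
        inf_eq_right.2 (genAtom_le k l _), inf_comm]
    rw [genAtom_succ hijkl, ρ.coxeterImage_e_inf hijkl le_sup_left, hkj, ← map_sup, ← map_inf,
      inf_sup_sup_inf_eq, ← genAtom_succ (i := j) (by grind)]

theorem coxeterImage_atom_succ {i j k l : Fin 4} (h : [i, j, k, l].Nodup) (n : ℕ) :
    ρ.coxeterImage i (atom i j k l (n + 1)) = ρ.toHom (genAtom i j (n + 1)) := by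
  rw [atom, coxeterImage_sup, coxeterImage_e_self, bot_sup_eq, e_fourth_inf_atom h,
    ρ.coxeterImage_genAtom (by grind)]

theorem coxeterImage_inf_atom {i j k l : Fin 4} (h : [i, j, k, l].Nodup) (y : D4) (n : ℕ) :
    ρ.coxeterImage i (y ⊓ atom i j k l n) = ρ.coxeterImage i y ⊓ ρ.toHom (genAtom i j n) := by
  cases n with
  | zero => rw [atom, inf_top_eq, genAtom_zero, inf_eq_left.2 (ρ.coxeterImage_le i y)]
  | succ n => rw [ρ.coxeterImage_inf_of_le_right (e_le_atom ..), ρ.coxeterImage_atom_succ h]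

theorem coxeterImage_inf_genAtom {i j k l : Fin 4} (h : [i, j, k, l].Nodup) {y : D4}
    (hy : y ≤ e j) (n : ℕ) :
    ρ.coxeterImage i (y ⊓ genAtom j k n) = ρ.coxeterImage i y ⊓ ρ.toHom (genAtom i l n) := by
  rw [inf_genAtom_eq (k := i) (l := l) (by grind) hy, ρ.coxeterImage_inf_atom (by grind)]

end CoxeterImage

end SubspaceRep

section Sequences

theorem SameSeq.symm {α β : List (Fin 4)} (h : SameSeq α β) : SameSeq β α :=
  Relation.EqvGen.symm _ _ h

theorem SameSeq.trans {α β γ : List (Fin 4)} (h : SameSeq α β) (h' : SameSeq β γ) : SameSeq α γ :=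
  Relation.EqvGen.trans _ _ _ h h'

theorem sameSeq_swap {i j k l : Fin 4} (h : [i, j, k, l].Nodup) (α : List (Fin 4)) :
    SameSeq (i :: j :: l :: α) (i :: k :: l :: α) :=
  .rel _ _ (.mk [] α i j k l h)

theorem SameSeq.lift {f : List (Fin 4) → List (Fin 4)} (hf : ∀ {α β}, Step α β → Step (f α) (f β))
    {α β : List (Fin 4)} (h : SameSeq α β) : SameSeq (f α) (f β) := by
  induction h with
  | rel _ _ h => exact .rel _ _ (hf h)
  | refl _ => exact .refl _
  | symm _ _ _ h => exact h.symm
  | trans _ _ _ _ _ h h' => exact h.trans h'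

theorem SameSeq.cons (i : Fin 4) {α β : List (Fin 4)} (h : SameSeq α β) :
    SameSeq (i :: α) (i :: β) :=
  h.lift (f := (i :: ·)) fun ⟨u, v, a, b, c, d, h⟩ => .mk (i :: u) v a b c d h

theorem SameSeq.map (σ : Equiv.Perm (Fin 4)) {α β : List (Fin 4)} (h : SameSeq α β) :
    SameSeq (α.map σ) (β.map σ) :=
  h.lift (f := List.map σ) fun ⟨u, v, a, b, c, d, h⟩ => by
    simpa only [List.map_append, List.map_cons, List.map_nil] using
      Step.mk (u.map σ) (v.map σ) (σ a) (σ b) (σ c) (σ d) (h.map σ.injective)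

/-- A replacement is a swap behind a prefix, so an invariant only has to survive swaps at the
front and the addition of a leading index. -/
theorem SameSeq.apply_eq {A : Sort*} {f : List (Fin 4) → A}
    (hswap : ∀ {i j k l} (v), [i, j, k, l].Nodup → f (i :: j :: l :: v) = f (i :: k :: l :: v))
    (hcons : ∀ i {α β}, α.head? = β.head? → f α = f β → f (i :: α) = f (i :: β))
    {α β : List (Fin 4)} (h : SameSeq α β) : f α = f β := by
  induction h with
  | rel _ _ h =>
    obtain ⟨u, v, i, j, k, l, h⟩ := h
    induction u with
    | nil => exact hswap v h
    | cons a u ih => exact hcons a (by cases u <;> rfl) ih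
  | refl _ => rfl
  | symm _ _ _ h => exact h.symm
  | trans _ _ _ _ _ h h' => exact h.trans h'

theorem SameSeq.head?_eq {α β : List (Fin 4)} (h : SameSeq α β) : α.head? = β.head? :=
  h.apply_eq (fun _ _ => rfl) fun _ _ _ _ _ => rfl

theorem SameSeq.getLast?_eq {α β : List (Fin 4)} (h : SameSeq α β) :
    α.getLast? = β.getLast? :=
  h.apply_eq (fun _ _ => by simp only [List.getLast?_cons_cons])
    fun _ _ _ _ h => by simp only [List.getLast?_cons, h]

/-- The number of pairs of adjacent indices of a sequence that lie in the matching `w`. These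
numbers turn out to be the lower indices of the atomic factors of `e_α`. -/
def pairCount (α : List (Fin 4)) (w : Fin 4) : ℕ := (α.zipWith matching α.tail).count w

theorem pairCount_singleton (i : Fin 4) : pairCount [i] = 0 := rfl

theorem pairCount_cons_cons (i j : Fin 4) (α : List (Fin 4)) :
    pairCount (i :: j :: α) = Pi.single (matching i j) 1 + pairCount (j :: α) := by
  ext w
  change (matching i j :: _).count w = _
  rw [List.count_cons, Pi.add_apply, Pi.single_apply, add_comm]
  simp only [beq_iff_eq, eq_comm (a := w)]
  rfl

theorem pairCount_cons_matching_self (i j : Fin 4) (α : List (Fin 4)) :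
    pairCount (i :: j :: α) (matching i j) = pairCount (j :: α) (matching j i) + 1 := by
  rw [pairCount_cons_cons, Pi.add_apply, Pi.single_eq_same, matching_comm j i, add_comm]

theorem pairCount_cons_matching_of_nodup {i j k l : Fin 4} (h : [i, j, k, l].Nodup)
    (α : List (Fin 4)) :
    pairCount (i :: j :: α) (matching i k) = pairCount (j :: α) (matching j l) := by
  rw [pairCount_cons_cons, Pi.add_apply, Pi.single_eq_of_ne (by grind [matching_right_inj]),
    zero_add, matching_eq_of_nodup (i := i) (j := k) (k := j) (l := l) (by grind)]

theorem SameSeq.pairCount_eq {α β : List (Fin 4)} (h : SameSeq α β) :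
    pairCount α = pairCount β := by
  refine h.apply_eq (fun {i j k l} v h => ?_) fun i α β hhead hcount => ?_
  · rw [pairCount_cons_cons, pairCount_cons_cons, pairCount_cons_cons, pairCount_cons_cons,
      matching_eq_of_nodup h, matching_eq_of_nodup (i := i) (j := k) (k := j) (l := l) (by grind),
      add_left_comm]
  · cases α <;> cases β <;> simp_all [pairCount_cons_cons]

theorem pairCount_zero_of_isChain {α : List (Fin 4)} (h : α.IsChain (· ≠ ·)) :
    pairCount α 0 = 0 := by
  induction α using List.twoStepInduction with
  | nil => rfl
  | singleton i => rfl
  | cons_cons i j α _ ih =>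
    rw [List.isChain_cons_cons] at h
    rw [pairCount_cons_cons, Pi.add_apply, ih _ h.2,
      Pi.single_eq_of_ne (matching_ne_zero.2 h.1).symm]

theorem exists_sameSeq_cons_cons {i j : Fin 4} {α : List (Fin 4)} (hij : i ≠ j)
    (hα : (j :: α).IsChain (· ≠ ·)) (hpos : pairCount (j :: α) (matching j i) ≠ 0) :
    ∃ β, (j :: i :: β).IsChain (· ≠ ·) ∧ SameSeq (j :: α) (j :: i :: β) := by
  induction α generalizing i j with
  | nil => exact absurd rfl hpos
  | cons m α ih =>
    by_cases hmi : m = i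
    · exact hmi ▸ ⟨α, hα, .refl _⟩
    obtain ⟨hjm, hα'⟩ := List.isChain_cons_cons.1 hα
    obtain ⟨k, hk⟩ : ∃ k, [j, m, i, k].Nodup := exists_nodup_of_triple (by grind)
    rw [pairCount_cons_cons, Pi.add_apply,
      Pi.single_eq_of_ne (by rwa [Ne, matching_right_inj, eq_comm]), zero_add,
      matching_eq_of_nodup (i := j) (j := i) (k := m) (l := k) (by grind)] at hpos
    obtain ⟨β, hβ, hαβ⟩ := ih (by grind) hα' hpos
    refine ⟨k :: β, ?_, (hαβ.cons j).trans (sameSeq_swap hk β)⟩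
    simp only [List.isChain_cons_cons] at hβ ⊢
    exact ⟨hij.symm, by grind, hβ.2⟩

theorem exists_sameSeq_of_pairCount_eq_succ {i j k l : Fin 4} (h : [j, i, k, l].Nodup)
    {α : List (Fin 4)} (hα : (j :: α).IsChain (· ≠ ·)) {x : ℕ}
    (hx : pairCount (j :: α) (matching j i) = x + 1) :
    ∃ β, (i :: β).IsChain (· ≠ ·) ∧ SameSeq (j :: α) (j :: i :: β) ∧
      pairCount (i :: β) (matching i j) = x ∧
      pairCount (i :: β) (matching i l) = pairCount (j :: α) (matching j k) ∧
      pairCount (i :: β) (matching i k) = pairCount (j :: α) (matching j l) := by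
  obtain ⟨β, hβ, hαβ⟩ := exists_sameSeq_cons_cons (i := i) (by grind) hα (by rw [hx]; lia)
  refine ⟨β, (List.isChain_cons_cons.1 hβ).2, hαβ, ?_, ?_, ?_⟩
  · rwa [hαβ.pairCount_eq, pairCount_cons_matching_self, add_left_inj] at hx
  · rw [hαβ.pairCount_eq, pairCount_cons_matching_of_nodup h]
  · rw [hαβ.pairCount_eq, pairCount_cons_matching_of_nodup (l := k) (by grind)]

theorem eq_nil_of_pairCount_eq_zero {i : Fin 4} {α : List (Fin 4)}
    (hα : (i :: α).IsChain (· ≠ ·)) (h : ∀ j ≠ i, pairCount (i :: α) (matching i j) = 0) :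
    α = [] := by
  rcases α with _ | ⟨j, α⟩
  · rfl
  · have hzero := h j (List.isChain_cons_cons.1 hα).1.symm
    rw [pairCount_cons_matching_self] at hzero
    lia

theorem sameSeq_of_pairCount_eq {α β : List (Fin 4)} (hα : Admissible α) (hβ : Admissible β)
    (hlast : α.getLast? = β.getLast?) (hcount : pairCount α = pairCount β) : SameSeq α β := by
  induction α generalizing β with
  | nil => exact absurd rfl hα.1
  | cons i α ih =>
    obtain ⟨j, β, rfl⟩ := List.exists_cons_of_ne_nil hβ.1
    rcases α with _ | ⟨k, α⟩
    · rcases β with _ | ⟨k, β⟩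
      · obtain rfl : i = j := by simpa only [List.getLast?_singleton, Option.some.injEq] using hlast
        exact .refl _
      · have hzero := congrFun hcount (matching j k)
        rw [pairCount_singleton, pairCount_cons_cons, Pi.add_apply, Pi.single_eq_same,
          Pi.zero_apply] at hzero
        lia
    obtain ⟨hik, hkα⟩ := List.isChain_cons_cons.1 hα.2
    obtain ⟨m, hm⟩ : ∃ m, matching j m = matching i k := exists_matching_eq j _
    obtain ⟨γ, hγ, hβγ⟩ := exists_sameSeq_cons_cons (i := m) (by grind [matching_ne_zero]) hβ.2 (by
      rw [hm, ← hcount, pairCount_cons_cons, Pi.add_apply, Pi.single_eq_same]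
      simp)
    have htail : SameSeq (k :: α) (m :: γ) := by
      refine ih ⟨List.cons_ne_nil _ _, hkα⟩
        ⟨List.cons_ne_nil _ _, (List.isChain_cons_cons.1 hγ).2⟩ ?_ ?_
      · rwa [hβγ.getLast?_eq, List.getLast?_cons_cons, List.getLast?_cons_cons] at hlast
      · rwa [hβγ.pairCount_eq, pairCount_cons_cons, pairCount_cons_cons, hm, add_right_inj]
          at hcount
    obtain rfl : k = m := by simpa using htail.head?_eq
    obtain rfl : j = i := matching_left_inj.1 hm
    exact (htail.cons j).trans hβγ.symm

end Sequences

namespace SubspaceRep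
variable {K : Type u} [Field K]

/-- The image in the space of `ρ` of `(Φ⁺)ⁿ⁻¹ρ(f i₁)` under the composition `φ_{iₙ} ⋯ φ_{i₂}` of
elementary maps that the sequence `iₙ … i₁` prescribes; a junk value for the empty sequence. -/
def seqImage (f : Fin 4 → D4) : List (Fin 4) → ∀ {X : Type v} [AddCommGroup X] [Module K X],
    SubspaceRep K X → Submodule K X
  | [], _, _, _, _ => ⊥
  | [j], _, _, _, ρ => ρ.toHom (f j)
  | i :: j :: β, _, _, _, ρ => (seqImage f (j :: β) ρ.coxeter).map (ρ.phi i)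

variable {X : Type v} [AddCommGroup X] [Module K X] (ρ : SubspaceRep K X)

theorem seqImage_cons_cons (f : Fin 4 → D4) (i j : Fin 4) (β : List (Fin 4)) :
    ρ.seqImage f (i :: j :: β) = (ρ.coxeter.seqImage f (j :: β)).map (ρ.phi i) := rfl

theorem seqImage_le {f : Fin 4 → D4} (hf : ∀ j, f j ≤ e j) (j : Fin 4) :
    ∀ β, ρ.seqImage f (j :: β) ≤ ρ.toHom (e j)
  | [] => ρ.toHom_mono (hf j)
  | _ :: _ => by
    rintro x ⟨ξ, -, rfl⟩
    exact ρ.phi_mem j ξ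

/-- The `i`-th coordinates of the components of `ξ ∈ X₀²` have sum zero, and those of `ξᵢ` and
`ξₗ` vanish; so `φᵢφⱼ = -φᵢφₖ` on `(Φ⁺)²ρ(eₗ)`. -/
theorem map_phi_map_phi {i j k l : Fin 4} (h : [i, j, k, l].Nodup)
    {S : Submodule K ρ.coxeter.coxeterSpace} (hS : S ≤ ρ.coxeter.coxeter.toHom (e l)) :
    (S.map (ρ.coxeter.phi j)).map (ρ.phi i) = (S.map (ρ.coxeter.phi k)).map (ρ.phi i) := by
  have hneg : ∀ ξ ∈ S, ρ.phi i (ρ.coxeter.phi j ξ) = -ρ.phi i (ρ.coxeter.phi k ξ) := by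
    intro ξ hξ
    have hi : ρ.phi i (ρ.coxeter.phi i ξ) = 0 := ρ.mem_coxeter_e.1 (ρ.coxeter.phi_mem i ξ)
    rw [ρ.coxeter.phi_eq_neg_add_neg (j := l) (k := i) (l := k) (by grind) (hS hξ), map_add,
      map_neg, map_neg, hi, neg_zero, zero_add]
  apply le_antisymm
  · rintro x ⟨_, ⟨ξ, hξ, rfl⟩, rfl⟩
    rw [hneg ξ hξ]
    exact neg_mem ⟨_, ⟨ξ, hξ, rfl⟩, rfl⟩
  · rintro x ⟨_, ⟨ξ, hξ, rfl⟩, rfl⟩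
    rw [← neg_eq_iff_eq_neg.2 (hneg ξ hξ)]
    exact neg_mem ⟨_, ⟨ξ, hξ, rfl⟩, rfl⟩

end SubspaceRep

theorem SameSeq.seqImage_eq {K : Type u} [Field K] {X : Type v} [AddCommGroup X] [Module K X]
    (ρ : SubspaceRep K X) {f : Fin 4 → D4} (hf : ∀ j, f j ≤ e j) {α β : List (Fin 4)}
    (h : SameSeq α β) : ρ.seqImage f α = ρ.seqImage f β := by
  suffices @SubspaceRep.seqImage K _ f α = @SubspaceRep.seqImage K _ f β by rw [this]
  refine h.apply_eq (fun v h => ?_) fun i α β hhead heq => ?_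
  · funext X _ _ ρ
    exact ρ.map_phi_map_phi h (ρ.coxeter.coxeter.seqImage_le hf _ v)
  · funext X _ _ ρ
    rcases α with _ | ⟨j, α⟩ <;> rcases β with _ | ⟨k, β⟩
    · rfl
    · cases hhead
    · cases hhead
    · rw [ρ.seqImage_cons_cons, heq, ← ρ.seqImage_cons_cons]

section Elements

/-- The element `e_j a b c` for the three atomic elements `a`, `b`, `c` that avoid `j`, with the
lower index of the one attached to `i` given by the value of `N` at the matching of `i` and `j`.
It is the element `e_α` if `α` starts with `j` and `N` counts its pairs. -/
def eElem (j : Fin 4) (N : Fin 4 → ℕ) : D4 :=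
  (Finset.univ.erase j).inf fun i => genAtom j i (N (matching j i))

theorem eElem_eq {j i k l : Fin 4} (h : [j, i, k, l].Nodup) (N : Fin 4 → ℕ) :
    eElem j N = genAtom j i (N (matching j i)) ⊓ genAtom j k (N (matching j k)) ⊓
      genAtom j l (N (matching j l)) := by
  rw [eElem, univ_erase_eq_of_nodup h, Finset.inf_insert, Finset.inf_insert,
    Finset.inf_singleton, inf_assoc]

theorem eElem_zero (j : Fin 4) : eElem j 0 = e j := by
  obtain ⟨i, k, l, h⟩ : ∃ i k l, [j, i, k, l].Nodup := by decide +revert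
  simp only [eElem_eq h, Pi.zero_apply, genAtom_zero, inf_idem]

/-- The element `f_{j0} = e_j(eᵢ + eₖ + eₗ)` of the sequence of length one. -/
def fBase (j : Fin 4) : D4 :=
  e j ⊓ (Finset.univ.erase j).sup' Finset.univ_nontrivial.erase_nonempty e

theorem fBase_le (j : Fin 4) : fBase j ≤ e j := inf_le_left

theorem fBase_eq {j i k l : Fin 4} (h : [j, i, k, l].Nodup) :
    fBase j = e j ⊓ (e i ⊔ e k ⊔ e l) := by
  rw [fBase, Finset.sup'_congr _ (univ_erase_eq_of_nodup h) fun _ _ => rfl]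
  simp only [Finset.sup'_insert, Finset.sup'_singleton, sup_assoc, Finset.insert_nonempty,
    Finset.singleton_nonempty]

/-- The element `f_{α0}` of a sequence that starts with `j`, computed from the atomic factor
`a_{x+1}` attached to `i`; the factors attached to `k` and `l` are `b_y` and `c_z`. -/
def fElem (j i k l : Fin 4) (x y z : ℕ) : D4 :=
  genAtom j i (x + 1) ⊓ genAtom j k y ⊓ genAtom j l z ⊓
    (genAtom j i x ⊓ genAtom j k (y + 1) ⊔ genAtom j i x ⊓ genAtom j l (z + 1))

theorem fElem_swap (j i k l : Fin 4) (x y z : ℕ) :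
    fElem j i k l x y z = fElem j i l k x z y := by
  rw [fElem, fElem, inf_right_comm (genAtom j i (x + 1)), sup_comm]

theorem fElem_eq_inf_sup {j i k l : Fin 4} {x y z : ℕ} {b c : D4}
    (hb : genAtom j i x ⊓ b = genAtom j i x ⊓ genAtom j k (y + 1))
    (hc : genAtom j i x ⊓ c = genAtom j i x ⊓ genAtom j l (z + 1)) :
    fElem j i k l x y z = genAtom j i (x + 1) ⊓ genAtom j k y ⊓ genAtom j l z ⊓
      (genAtom j i x ⊓ c ⊔ b) := by
  have hle : genAtom j i (x + 1) ⊓ genAtom j k y ⊓ genAtom j l z ≤ genAtom j i x :=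
    inf_le_left.trans (inf_le_left.trans (genAtom_succ_le j i x))
  rw [inf_inf_sup_eq_of_le hle, hb, hc, sup_comm, fElem]

theorem fElem_eq_inf_sup_inf {j i k l : Fin 4} {x y z : ℕ} {a b c : D4}
    (ha : e j ⊓ a = genAtom j i x) (hb : e j ⊓ b = genAtom j k (y + 1))
    (hc : e j ⊓ c = genAtom j l (z + 1)) :
    fElem j i k l x y z = genAtom j i (x + 1) ⊓ genAtom j k y ⊓ genAtom j l z ⊓
      (e j ⊓ c ⊔ b ⊓ a) := by
  have hle : genAtom j i (x + 1) ⊓ genAtom j k y ⊓ genAtom j l z ≤ genAtom j i x :=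
    inf_le_left.trans (inf_le_left.trans (genAtom_succ_le j i x))
  have hinf (d : D4) : genAtom j i x ⊓ (e j ⊓ d) = genAtom j i x ⊓ d := by
    rw [← inf_assoc, inf_eq_left.2 (genAtom_le j i x)]
  rw [inf_inf_sup_inf_eq_of_le (hle.trans (genAtom_le j i x))
      (hle.trans (ha.symm.le.trans inf_le_right)), ha,
    fElem_eq_inf_sup (b := genAtom j i x ⊓ b) (c := c)
      (by rw [← hb, hinf, ← inf_assoc, inf_idem]) (by rw [← hc, hinf])]

end Elements

namespace SubspaceRep
variable {K : Type u} {X : Type v} [Field K] [AddCommGroup X] [Module K X] (ρ : SubspaceRep K X)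
  {i j k l : Fin 4}

theorem coxeterImage_inf_three (h : [i, j, k, l].Nodup) (x y z : ℕ) :
    ρ.coxeterImage i (genAtom j i x ⊓ genAtom j k y ⊓ genAtom j l z) =
      ρ.toHom (genAtom i j (x + 1) ⊓ genAtom i l y ⊓ genAtom i k z) := by
  have hle := genAtom_le j i x
  rw [ρ.coxeterImage_inf_genAtom (k := l) (l := k) (by grind) (inf_le_of_left_le hle),
    ρ.coxeterImage_inf_genAtom h hle, ρ.coxeterImage_genAtom (by grind), ← map_inf, ← map_inf]

theorem coxeterImage_eElem (hij : i ≠ j) (N : Fin 4 → ℕ) :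
    ρ.coxeterImage i (eElem j N) = ρ.toHom (eElem i (Pi.single (matching i j) 1 + N)) := by
  obtain ⟨k, l, h⟩ := exists_nodup hij
  rw [eElem_eq (i := i) (k := k) (l := l) (by grind), ρ.coxeterImage_inf_three h,
    eElem_eq (j := i) (i := j) (k := l) (l := k) (by grind)]
  have hk : matching i l = matching j k := matching_eq_of_nodup (by grind)
  have hl : matching i k = matching j l := matching_eq_of_nodup (by grind)
  simp only [Pi.add_apply, Pi.single_eq_same]
  rw [Pi.single_eq_of_ne (by grind [matching_right_inj]),
    Pi.single_eq_of_ne (by grind [matching_right_inj]), matching_comm j i, hk, hl, zero_add,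
    zero_add, add_comm 1]

theorem toHom_eElem_eq_seqImage {j : Fin 4} {β : List (Fin 4)}
    (hβ : (j :: β).IsChain (· ≠ ·)) :
    ρ.toHom (eElem j (pairCount (j :: β))) = ρ.seqImage e (j :: β) := by
  induction β generalizing X j with
  | nil => rw [pairCount_singleton, eElem_zero]; rfl
  | cons k β ih =>
    obtain ⟨hjk, hkβ⟩ := List.isChain_cons_cons.1 hβ
    rw [pairCount_cons_cons, ← ρ.coxeterImage_eElem hjk, coxeterImage, ih _ hkβ,
      seqImage_cons_cons]

theorem coxeterImage_fBase (h : [i, j, k, l].Nodup) :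
    ρ.coxeterImage i (fBase j) = ρ.toHom (fElem i j k l 0 0 0) := by
  have hone {m : Fin 4} (hm : i ≠ m) : ρ.coxeterImage i (e m) = ρ.toHom (genAtom i m 1) := by
    rw [← genAtom_zero m i, ρ.coxeterImage_genAtom hm]
  obtain ⟨hij, hik, hil⟩ : i ≠ j ∧ i ≠ k ∧ i ≠ l := by grind
  rw [fBase_eq (i := i) (k := k) (l := l) (by grind),
    ρ.coxeterImage_inf_of_le_right (le_sup_left.trans le_sup_left), ρ.coxeterImage_sup,
    ρ.coxeterImage_sup, ρ.coxeterImage_e_self, bot_sup_eq, hone hij, hone hik, hone hil,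
    ← map_sup, ← map_inf, fElem]
  simp only [genAtom_zero, zero_add, inf_eq_right.2 (genAtom_le i _ _),
    inf_eq_left.2 (genAtom_le i _ _)]

theorem coxeterImage_fElem_left (h : [i, j, k, l].Nodup) (x y z : ℕ) :
    ρ.coxeterImage i (fElem j i k l x y z) = ρ.toHom (fElem i j l k (x + 1) y z) := by
  obtain ⟨hk, hl, hik, hil⟩ :
    [k, j, i, l].Nodup ∧ [l, j, i, k].Nodup ∧ [i, k, l, j].Nodup ∧ [i, l, k, j].Nodup := by grind
  have hle := genAtom_le j i x
  rw [fElem_eq_inf_sup (inf_genAtom_eq hk hle _).symm (inf_genAtom_eq hl hle _).symm,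
    ρ.coxeterImage_inf_of_le_right (le_sup_of_le_right (e_le_atom ..)), ρ.coxeterImage_inf_three h,
    ρ.coxeterImage_sup, ρ.coxeterImage_inf_atom hik, ρ.coxeterImage_atom_succ hil,
    ρ.coxeterImage_genAtom (by grind), ← map_inf, ← map_sup, ← map_inf, fElem_eq_inf_sup rfl rfl]

theorem coxeterImage_fElem_right (h : [i, j, k, l].Nodup) (x y z : ℕ) :
    ρ.coxeterImage i (fElem j k i l x y z) = ρ.toHom (fElem i l j k x (y + 1) z) := by
  obtain ⟨hk, hl, hik, hil⟩ :
    [k, j, i, l].Nodup ∧ [l, j, i, k].Nodup ∧ [i, k, l, j].Nodup ∧ [i, l, k, j].Nodup := by grind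
  have hprod : ρ.coxeterImage i (genAtom j k (x + 1) ⊓ genAtom j l z ⊓ genAtom j i y) =
      ρ.toHom (genAtom i l (x + 1) ⊓ genAtom i j (y + 1) ⊓ genAtom i k z) := by
    rw [inf_comm, ← inf_assoc, ρ.coxeterImage_inf_three h, inf_comm (genAtom i j _)]
  have hmeet : ρ.coxeterImage i (atom i k l j (z + 1) ⊓ atom i l k j x) =
      ρ.toHom (genAtom i l x ⊓ genAtom i k (z + 1)) := by
    rw [ρ.coxeterImage_inf_atom hil, ρ.coxeterImage_atom_succ hik, ← map_inf, inf_comm]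
  rw [fElem_swap, fElem_eq_inf_sup_inf (e_fourth_inf_atom hk _) (e_fourth_inf_atom hl _)
      (e_fourth_inf_atom h _), e_fourth_inf_atom h,
    ρ.coxeterImage_inf_of_le_right (le_sup_of_le_right (le_inf (e_le_atom ..) (e_le_atom ..))),
    ρ.coxeterImage_sup, hprod, hmeet, ρ.coxeterImage_genAtom (by grind), sup_comm, ← map_sup,
    ← map_inf, fElem_eq_inf_sup rfl rfl]

/-- A pair that is counted can be brought to the front, where `φⱼ` lowers its count. -/
theorem toHom_fElem_eq_seqImage {β : List (Fin 4)} {x y z : ℕ} (h : [j, i, k, l].Nodup)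
    (hβ : (j :: β).IsChain (· ≠ ·)) (hx : pairCount (j :: β) (matching j i) = x + 1)
    (hy : pairCount (j :: β) (matching j k) = y) (hz : pairCount (j :: β) (matching j l) = z) :
    ρ.toHom (fElem j i k l x y z) = ρ.seqImage fBase (j :: β) := by
  induction hn : x + y + z generalizing X i j k l β x y z with
  | zero =>
    obtain ⟨rfl, rfl, rfl⟩ : x = 0 ∧ y = 0 ∧ z = 0 := by lia
    obtain ⟨γ, hγ, hβγ, hγj, hγl, hγk⟩ := exists_sameSeq_of_pairCount_eq_succ h hβ hx
    obtain rfl : γ = [] := eq_nil_of_pairCount_eq_zero hγ fun m hm => by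
      obtain rfl | rfl | rfl : m = j ∨ m = l ∨ m = k := by grind
      exacts [hγj, hγl.trans hy, hγk.trans hz]
    rw [hβγ.seqImage_eq ρ fBase_le]
    exact (ρ.coxeterImage_fBase h).symm
  | succ n ih =>
    by_cases hx0 : x = 0
    · wlog hy0 : y ≠ 0 generalizing k l y z
      · rw [fElem_swap]
        exact this (by grind) hz hy (by lia) (by lia)
      obtain ⟨y, rfl⟩ := Nat.exists_eq_succ_of_ne_zero hy0
      obtain ⟨γ, hγ, hβγ, hγj, hγi, hγl⟩ :=
        exists_sameSeq_of_pairCount_eq_succ (i := k) (k := l) (l := i) (by grind) hβ hy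
      rw [hβγ.seqImage_eq ρ fBase_le, ρ.seqImage_cons_cons, ← ih ρ.coxeter (i := l) (k := j)
        (l := i) (by grind) hγ (hγl.trans hx) hγj (hγi.trans hz) (by lia)]
      exact (ρ.coxeterImage_fElem_right (by grind) x y z).symm
    · obtain ⟨x, rfl⟩ := Nat.exists_eq_succ_of_ne_zero hx0
      obtain ⟨γ, hγ, hβγ, hγj, hγl, hγk⟩ := exists_sameSeq_of_pairCount_eq_succ h hβ hx
      rw [hβγ.seqImage_eq ρ fBase_le, ρ.seqImage_cons_cons, ← ih ρ.coxeter (i := j) (k := l)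
        (l := k) (by grind) hγ hγj (hγl.trans hy) (hγk.trans hz) (by lia)]
      exact (ρ.coxeterImage_fElem_left (by grind) x y z).symm

end SubspaceRep

section Table

theorem matching_perm_eq_iff (σ : Equiv.Perm (Fin 4)) {i j a b : Fin 4} (hij : i ≠ j)
    (hab : a ≠ b) : matching (σ a) (σ b) = matching (σ i) (σ j) ↔ matching a b = matching i j := by
  have key {i j a b : Fin 4} (hij : i ≠ j) (hab : a ≠ b) : matching a b = matching i j ↔
      [a, b] = [i, j] ∨ [a, b] = [j, i] ∨ [i, j, a, b].Nodup := by
    decide +revert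
  rw [key hij hab, key (σ.injective.ne hij) (σ.injective.ne hab)]
  simp [σ.injective.eq_iff]

theorem pairCount_map (σ : Equiv.Perm (Fin 4)) {i j : Fin 4} (hij : i ≠ j) {α : List (Fin 4)}
    (hα : α.IsChain (· ≠ ·)) :
    pairCount (α.map σ) (matching (σ i) (σ j)) = pairCount α (matching i j) := by
  induction α with
  | nil => rfl
  | cons a α ih =>
    rcases α with _ | ⟨b, α⟩
    · rfl
    · obtain ⟨hab, hα⟩ := List.isChain_cons_cons.1 hα
      simp only [List.map_cons] at ih ⊢
      simp only [pairCount_cons_cons, Pi.add_apply, ih hα, Pi.single_apply,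
        eq_comm (a := matching (σ i) (σ j)), eq_comm (a := matching i j),
        matching_perm_eq_iff σ hij hab]

theorem Admissible.map {α : List (Fin 4)} (hα : Admissible α) (σ : Equiv.Perm (Fin 4)) :
    Admissible (α.map σ) :=
  ⟨by simpa using hα.1, List.isChain_map σ |>.2 (hα.2.imp fun _ _ h => σ.injective.ne h)⟩

theorem pw_succ (i j : Fin 4) (n : ℕ) : pw i j (n + 1) = i :: j :: pw i j n := by
  simp [pw, List.replicate_succ]

theorem pairCount_pw_append (i j : Fin 4) (n : ℕ) (β : List (Fin 4)) :
    pairCount (j :: (pw i j n ++ β)) = Pi.single (matching i j) (2 * n) + pairCount (j :: β) := by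
  induction n with
  | zero => simp [pw]
  | succ n ih =>
    rw [pw_succ, List.cons_append, List.cons_append, pairCount_cons_cons, pairCount_cons_cons, ih,
      matching_comm j i, ← add_assoc, ← add_assoc, ← Pi.single_add, ← Pi.single_add]
    congr 2
    ring

theorem pairCount_pw (i j : Fin 4) (n : ℕ) :
    pairCount (j :: pw i j n) = Pi.single (matching i j) (2 * n) := by
  simpa [pairCount_singleton] using pairCount_pw_append i j n []

theorem isChain_pw_append {i j : Fin 4} (h : i ≠ j) (n : ℕ) (β : List (Fin 4)) :
    (j :: (pw i j n ++ β)).IsChain (· ≠ ·) ↔ (j :: β).IsChain (· ≠ ·) := by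
  induction n with
  | zero => simp [pw]
  | succ n ih => simpa [pw_succ, h, h.symm] using ih

theorem isChain_pw {i j : Fin 4} (h : i ≠ j) (n : ℕ) : (j :: pw i j n).IsChain (· ≠ ·) := by
  simpa using (isChain_pw_append h n []).2 (List.isChain_singleton _)

theorem getLast?_pw_append (i j : Fin 4) (n : ℕ) (β : List (Fin 4)) :
    (j :: (pw i j n ++ β)).getLast? = (j :: β).getLast? := by
  induction n with
  | zero => simp [pw]
  | succ n ih => simpa [pw_succ, List.getLast?_cons_cons] using ih

theorem getLast?_pw (i j : Fin 4) (n : ℕ) : (j :: pw i j n).getLast? = some j := by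
  simpa using getLast?_pw_append i j n []

end Table

namespace AdmType
variable {T : AdmType} {t r s : ℕ}

/-- The index that forms a pair with the leading index in the matching of the `m`-th atomic
factor, so that the product of `e_{iₙ}` and this factor is `genAtom T.lead (T.partner m) n`. -/
def partner : AdmType → Fin 3 → Fin 4
  | .F21 => ![1, 3, 4]
  | .F31 => ![1, 2, 4]
  | .F41 => ![1, 2, 3]
  | .G11 => ![2, 4, 3]
  | .G21 => ![1, 3, 4]
  | .G31 => ![1, 2, 4]
  | .G41 => ![1, 3, 2]
  | .H11 => ![2, 4, 3]
  | .H21 => ![1, 3, 4]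
  | .H31 => ![4, 2, 1]
  | .H41 => ![3, 1, 2]

theorem lead_ne_partner (T : AdmType) (m : Fin 3) : T.lead ≠ T.partner m := by
  cases T <;> decide +revert

theorem exists_matching_partner_eq (T : AdmType) {w : Fin 4} (hw : w ≠ 0) :
    ∃ m, matching T.lead (T.partner m) = w := by
  cases T <;> decide +revert

theorem partner_perm_nodup (T : AdmType) (σ : Equiv.Perm (Fin 4)) (π : Equiv.Perm (Fin 3)) :
    [σ T.lead, σ (T.partner (π 0)), σ (T.partner (π 1)), σ (T.partner (π 2))].Nodup := by
  have hpartner : [T.lead, T.partner (π 0), T.partner (π 1), T.partner (π 2)].Nodup := by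
    have hinj : Function.Injective T.partner := by cases T <;> decide
    have hπ : [π 0, π 1, π 2].Nodup := List.Nodup.map (l := [0, 1, 2]) π.injective (by decide)
    refine List.nodup_cons.2 ⟨?_, hπ.map hinj⟩
    simp [lead_ne_partner]
  exact hpartner.map σ.injective

theorem exists_word_eq_lead_cons (h : T.Valid t r s) : ∃ β, T.word t r s = T.lead :: β := by
  cases T
  case' F21 | F31 | F41 => obtain ⟨t, rfl⟩ := Nat.exists_eq_add_of_le' h
  case' G21 | G31 | G41 => obtain ⟨r, rfl⟩ := Nat.exists_eq_add_of_le' h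
  case' H11 | H21 | H31 | H41 =>
    obtain ⟨⟨r, rfl⟩, ⟨s, rfl⟩⟩ := h.imp Nat.exists_eq_add_of_le' Nat.exists_eq_add_of_le'
  all_goals simp [word, pw_succ, lead]

theorem admissible_word (h : T.Valid t r s) : Admissible (T.word t r s) := by
  refine ⟨fun hnil => by simpa [hnil] using exists_word_eq_lead_cons h, ?_⟩
  cases T
  case' F21 | F31 | F41 => obtain ⟨t, rfl⟩ := Nat.exists_eq_add_of_le' h
  case' G21 | G31 | G41 => obtain ⟨r, rfl⟩ := Nat.exists_eq_add_of_le' h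
  case' H11 | H21 | H31 | H41 =>
    obtain ⟨⟨r, rfl⟩, ⟨s, rfl⟩⟩ := h.imp Nat.exists_eq_add_of_le' Nat.exists_eq_add_of_le'
  all_goals simp [word, pw_succ, isChain_pw, isChain_pw_append]

theorem getLast?_word (h : T.Valid t r s) : (T.word t r s).getLast? = some 1 := by
  cases T
  case' F21 | F31 | F41 => obtain ⟨t, rfl⟩ := Nat.exists_eq_add_of_le' h
  case' G21 | G31 | G41 => obtain ⟨r, rfl⟩ := Nat.exists_eq_add_of_le' h
  case' H11 | H21 | H31 | H41 =>
    obtain ⟨⟨r, rfl⟩, ⟨s, rfl⟩⟩ := h.imp Nat.exists_eq_add_of_le' Nat.exists_eq_add_of_le'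
  all_goals simp [word, pw_succ, getLast?_pw, getLast?_pw_append]

theorem pairCount_word (h : T.Valid t r s) (m : Fin 3) :
    pairCount (T.word t r s) (matching T.lead (T.partner m)) = (T.factor t r s m).n := by
  cases T
  case' F21 | F31 | F41 => obtain ⟨t, rfl⟩ := Nat.exists_eq_add_of_le' h
  case' G21 | G31 | G41 => obtain ⟨r, rfl⟩ := Nat.exists_eq_add_of_le' h
  case' H11 | H21 | H31 | H41 =>
    obtain ⟨⟨r, rfl⟩, ⟨s, rfl⟩⟩ := h.imp Nat.exists_eq_add_of_le' Nat.exists_eq_add_of_le'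
  all_goals
    fin_cases m <;>
      simp +decide [word, pw_succ, lead, partner, factor, pairCount_pw, pairCount_pw_append,
        pairCount_cons_cons, matching] <;> lia

theorem exists_factor_eq (N : Fin 4 → ℕ) : ∃ (T : AdmType) (t r s : ℕ), T.Valid t r s ∧
    ∀ m, (T.factor t r s m).n = N (matching T.lead (T.partner m)) := by
  have of_three {T : AdmType} {t r s : ℕ} (hv : T.Valid t r s)
      (h0 : N (matching T.lead (T.partner 0)) = (T.factor t r s 0).n)
      (h1 : N (matching T.lead (T.partner 1)) = (T.factor t r s 1).n)
      (h2 : N (matching T.lead (T.partner 2)) = (T.factor t r s 2).n) :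
      ∃ (T : AdmType) (t r s : ℕ), T.Valid t r s ∧
        ∀ m, (T.factor t r s m).n = N (matching T.lead (T.partner m)) :=
    ⟨T, t, r, s, hv, fun m => by fin_cases m; exacts [h0.symm, h1.symm, h2.symm]⟩
  obtain ⟨p, hp | hp⟩ := Nat.even_or_odd' (N (matching 1 2)) <;>
    obtain ⟨q, hq | hq⟩ := Nat.even_or_odd' (N (matching 1 4)) <;>
    obtain ⟨r, hr | hr⟩ := Nat.even_or_odd' (N (matching 1 3))
  · exact of_three (T := .G11) (t := p) (r := q) (s := r) trivial hp hq hr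
  · exact of_three (T := .F31) (t := r + 1) (r := q) (s := p) (Nat.succ_pos _) hr hq hp
  · exact of_three (T := .F41) (t := q + 1) (r := r) (s := p) (Nat.succ_pos _) hq hr hp
  · exact of_three (T := .G21) (t := p) (r := q + 1) (s := r) (Nat.succ_pos _) hp hq hr
  · exact of_three (T := .F21) (t := p + 1) (r := q) (s := r) (Nat.succ_pos _) hp hq hr
  · exact of_three (T := .G41) (t := q) (r := p + 1) (s := r) (Nat.succ_pos _) hq hp hr
  · exact of_three (T := .G31) (t := r) (r := q + 1) (s := p) (Nat.succ_pos _) hr hq hp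
  · exact of_three (T := .H11) (t := p) (r := q + 1) (s := r + 1)
      ⟨Nat.succ_pos _, Nat.succ_pos _⟩ hp hq hr

end AdmType

section TableElements
variable {σ : Equiv.Perm (Fin 4)} {T : AdmType} {t r s : ℕ} {α : List (Fin 4)}

theorem exists_sameSeq_word (σ : Equiv.Perm (Fin 4)) (hα : Admissible α)
    (hlast : α.getLast? = some (σ 1)) :
    ∃ (T : AdmType) (t r s : ℕ), T.Valid t r s ∧ SameSeq α ((T.word t r s).map σ) := by
  have hσα := hα.map σ.symm
  obtain ⟨T, t, r, s, hv, hfactor⟩ := AdmType.exists_factor_eq (pairCount (α.map σ.symm))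
  have hword := AdmType.admissible_word hv
  have hcount : pairCount (α.map σ.symm) = pairCount (T.word t r s) := by
    funext w
    by_cases hw : w = 0
    · rw [hw, pairCount_zero_of_isChain hσα.2, pairCount_zero_of_isChain hword.2]
    · obtain ⟨m, rfl⟩ := T.exists_matching_partner_eq hw
      rw [AdmType.pairCount_word hv, hfactor]
  have hsame : SameSeq (α.map σ.symm) (T.word t r s) :=
    sameSeq_of_pairCount_eq hσα hword
      (by simp [List.getLast?_map, hlast, AdmType.getLast?_word hv]) hcount
  exact ⟨T, t, r, s, hv, by simpa using hsame.map σ⟩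

theorem pairCount_of_sameSeq_word (hv : T.Valid t r s) (h : SameSeq α ((T.word t r s).map σ))
    (m : Fin 3) :
    pairCount α (matching (σ T.lead) (σ (T.partner m))) = (T.factor t r s m).n := by
  rw [h.pairCount_eq, pairCount_map σ (T.lead_ne_partner m) (AdmType.admissible_word hv).2,
    AdmType.pairCount_word hv]

theorem eq_lead_of_sameSeq_word {j : Fin 4} {β : List (Fin 4)} (hv : T.Valid t r s)
    (h : SameSeq (j :: β) ((T.word t r s).map σ)) : j = σ T.lead := by
  obtain ⟨γ, hγ⟩ := AdmType.exists_word_eq_lead_cons hv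
  simpa [hγ] using h.head?_eq

theorem e_inf_factor_elem (σ : Equiv.Perm (Fin 4)) (T : AdmType) (t r s : ℕ) (m : Fin 3) (n : ℕ) :
    e (σ T.lead) ⊓ (T.factor t r s m).elem σ n = genAtom (σ T.lead) (σ (T.partner m)) n := by
  set a := T.factor t r s m with ha
  have hnodup : [a.k, a.l, a.i, a.j].Nodup := by
    rw [ha]; cases T <;> fin_cases m <;> simp [AdmType.factor]
  have hpair : a.k = T.lead ∧ a.l = T.partner m ∨ a.k = T.partner m ∧ a.l = T.lead := by
    rw [ha]; cases T <;> fin_cases m <;> simp [AdmType.factor, AdmType.lead, AdmType.partner]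
  obtain ⟨hk, hl⟩ | ⟨hk, hl⟩ := hpair <;> rw [← hk, ← hl]
  · exact e_third_inf_atom (hnodup.map σ.injective) n
  · exact e_fourth_inf_atom (hnodup.map σ.injective) n

theorem inf_univ_perm {L : Type*} [SemilatticeInf L] [OrderTop L] (g : Fin 3 → L)
    (π : Equiv.Perm (Fin 3)) : Finset.univ.inf g = g (π 0) ⊓ g (π 1) ⊓ g (π 2) := by
  have huniv : (Finset.univ : Finset (Fin 3)) = {π 0, π 1, π 2} := by decide +revert
  rw [huniv, Finset.inf_insert, Finset.inf_insert, Finset.inf_singleton, inf_assoc]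

theorem tableE_eq_inf_genAtom (σ : Equiv.Perm (Fin 4)) (T : AdmType) (t r s : ℕ) :
    tableE σ T t r s =
      Finset.univ.inf fun m => genAtom (σ T.lead) (σ (T.partner m)) (T.factor t r s m).n := by
  simp only [inf_univ_perm _ 1, Equiv.Perm.one_apply, ← e_inf_factor_elem σ T t r s, tableE]
  ac_rfl

theorem tableE_eq_eElem (hv : T.Valid t r s) (h : SameSeq α ((T.word t r s).map σ)) :
    tableE σ T t r s = eElem (σ T.lead) (pairCount α) := by
  simp only [eElem_eq (T.partner_perm_nodup σ 1), pairCount_of_sameSeq_word hv h,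
    tableE_eq_inf_genAtom, inf_univ_perm _ 1]

theorem exists_isE (hα : Admissible α) : ∃ z, IsE α z := by
  have hlast := List.getLast?_eq_some_getLast hα.1
  obtain ⟨T, t, r, s, hv, hs⟩ :=
    exists_sameSeq_word (Equiv.swap 1 (α.getLast hα.1)) hα (by simpa using hlast)
  exact ⟨_, _, T, t, r, s, hv, hs, rfl⟩

theorem exists_tableF (σ : Equiv.Perm (Fin 4)) (hv : T.Valid t r s) : ∃ z, TableF σ T t r s z := by
  by_cases h : ∃ m, 1 ≤ (T.factor t r s m).n
  · obtain ⟨m, hm⟩ := h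
    exact ⟨_, .mk T t r s (Equiv.swap 0 m) (by simpa using hm)⟩
  · obtain ⟨h0, h1, h2⟩ : (T.factor t r s 0).n = 0 ∧ (T.factor t r s 1).n = 0 ∧
        (T.factor t r s 2).n = 0 := by
      simp only [not_exists, not_le, Nat.lt_one_iff] at h
      exact ⟨h 0, h 1, h 2⟩
    cases T
    case G11 =>
      obtain ⟨rfl, rfl, rfl⟩ : t = 0 ∧ r = 0 ∧ s = 0 := by
        simp only [AdmType.factor, Matrix.cons_val] at h0 h1 h2
        lia
      exact ⟨_, .one⟩
    all_goals
      simp only [AdmType.factor, AdmType.Valid, Matrix.cons_val] at h0 h1 h2 hv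
      lia

theorem exists_isF (hα : Admissible α) : ∃ z, IsF α z := by
  obtain ⟨_, σ, T, t, r, s, hv, hs, -⟩ := exists_isE hα
  obtain ⟨z, hz⟩ := exists_tableF σ hv
  exact ⟨z, σ, T, t, r, s, hv, hs, hz⟩

variable {K : Type u} {X : Type v} [Field K] [AddCommGroup X] [Module K X] (ρ : SubspaceRep K X)
  {z : D4}

theorem IsE.toHom_eq (h : IsE α z) (hα : Admissible α) : ρ.toHom z = ρ.seqImage e α := by
  obtain ⟨σ, T, t, r, s, hv, hs, rfl⟩ := h
  rcases α with _ | ⟨j, β⟩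
  · exact absurd rfl hα.1
  rw [tableE_eq_eElem hv hs, ← eq_lead_of_sameSeq_word hv hs, ρ.toHom_eElem_eq_seqImage hα.2]

theorem IsF.toHom_eq (h : IsF α z) (hα : Admissible α) : ρ.toHom z = ρ.seqImage fBase α := by
  obtain ⟨σ, T, t, r, s, hv, hs, hf⟩ := h
  rcases α with _ | ⟨j, β⟩
  · exact absurd rfl hα.1
  obtain rfl := eq_lead_of_sameSeq_word hv hs
  cases hf with
  | one =>
    obtain rfl : β = [] := eq_nil_of_pairCount_eq_zero hα.2 fun j _ =>
      congrFun (hs.pairCount_eq.trans (pairCount_singleton _)) _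
    have hnodup : [(1 : Fin 4), 2, 3, 4].Nodup := by decide
    exact congrArg ρ.toHom (fBase_eq (hnodup.map σ.injective)).symm
  | mk _ _ _ _ π hx =>
    rw [tableE_eq_inf_genAtom, inf_univ_perm _ π,
      ← ρ.toHom_fElem_eq_seqImage (T.partner_perm_nodup σ π) hα.2
        (x := (T.factor t r s (π 0)).n - 1)
        (by rw [pairCount_of_sameSeq_word hv hs, Nat.sub_add_cancel hx])
        (pairCount_of_sameSeq_word hv hs _) (pairCount_of_sameSeq_word hv hs _),
      fElem_eq_inf_sup_inf (e_inf_factor_elem σ T t r s ..) (e_inf_factor_elem σ T t r s ..)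
        (e_inf_factor_elem σ T t r s ..), Nat.sub_add_cancel hx]

end TableElements

end D4Lattice

theorem mainTheorem8_general :
    (∀ (α : List (Fin 4)) (σ : Equiv.Perm (Fin 4)), Admissible α → α.getLast? = some (σ 1) →
      ∃ (T : AdmType) (t r s : ℕ), T.Valid t r s ∧ SameSeq α ((T.word t r s).map σ)) ∧
    ∀ (α : List (Fin 4)) (i : Fin 4), Admissible α → α.head? ≠ some i →
      Admissible (i :: α) ∧
      (∃ z, IsE α z) ∧ (∃ z, IsE (i :: α) z) ∧ (∃ z, IsF α z) ∧ (∃ z, IsF (i :: α) z) ∧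
      ∀ (K X : Type*) [Field K] [AddCommGroup X] [Module K X] (ρ : SubspaceRep K X),
        (∀ z z', IsE α z → IsE (i :: α) z' →
          (ρ.coxeter.toHom z).map (ρ.phi i) = ρ.toHom z') ∧
        (∀ z z', IsF α z → IsF (i :: α) z' →
          (ρ.coxeter.toHom z).map (ρ.phi i) = ρ.toHom z') := by
  refine ⟨fun α σ hα => exists_sameSeq_word σ hα, fun α i hα hi => ?_⟩
  obtain ⟨j, β, rfl⟩ := List.exists_cons_of_ne_nil hα.1
  have hiα : Admissible (i :: j :: β) :=
    ⟨List.cons_ne_nil _ _, List.isChain_cons_cons.2 ⟨fun hij => hi (hij ▸ rfl), hα.2⟩⟩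
  refine ⟨hiα, exists_isE hα, exists_isE hiα, exists_isF hα, exists_isF hiα,
    fun K X _ _ _ ρ => ⟨fun z z' hz hz' => ?_, fun z z' hz hz' => ?_⟩⟩
  · rw [hz.toHom_eq ρ.coxeter hα, hz'.toHom_eq ρ hiα, ρ.seqImage_cons_cons]
  · rw [hz.toHom_eq ρ.coxeter hα, hz'.toHom_eq ρ hiα, ρ.seqImage_cons_cons]

theorem mainTheorem8 :
    (∀ (α : List (Fin 4)) (σ : Equiv.Perm (Fin 4)), Admissible α → α.getLast? = some (σ 1) →
      ∃ (T : AdmType) (t r s : ℕ), T.Valid t r s ∧ SameSeq α ((T.word t r s).map σ)) ∧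
    ∀ (α : List (Fin 4)) (i : Fin 4), Admissible α → α.head? ≠ some i →
      Admissible (i :: α) ∧
      (∃ z, IsE α z) ∧ (∃ z, IsE (i :: α) z) ∧ (∃ z, IsF α z) ∧ (∃ z, IsF (i :: α) z) ∧
      ∀ (K X : Type*) [Field K] [AddCommGroup X] [Module K X] [FiniteDimensional K X]
        (ρ : SubspaceRep K X),
        (∀ z z', IsE α z → IsE (i :: α) z' →
          (ρ.coxeter.toHom z).map (ρ.phi i) = ρ.toHom z') ∧
        (∀ z z', IsF α z → IsF (i :: α) z' →
          (ρ.coxeter.toHom z).map (ρ.phi i) = ρ.toHom z') := by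
  refine mainTheorem8_general.imp_right fun h α i hα hi => ?_
  obtain ⟨hiα, he, hie, hf, hif, hmap⟩ := h α i hα hi
  exact ⟨hiα, he, hie, hf, hif, fun K X _ _ _ _ ρ => hmap K X ρ⟩
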